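/- Let $\mathbb K\in\{\mathbb R,\mathbb C\}$, and let $X$ be a closed subspace of $c_0$ (the space of $\mathbb K$-valued null sequences with the supremum norm) that has a monotone Schauder basis $(e_n)_{n\ge 1}$, that is, a Schauder basis all of whose partial sum projections $P_n\colon X\to X$ satisfy $\|P_n\|\le 1$. Then $(e_n)$ is shrinking, i.e. its coordinate functionals $(e_n^*)$ form a Schauder basis of the dual space $X^*$; and for every Banach space $Y$ over $\mathbb K$ the set $NA(X,Y)\cap K(X,Y)$ is dense, for the operator norm, in $K(X,Y)$. Here $K(X,Y)$ is the space of compact linear operators from $X$ to $Y$, and $NA(X,Y)$ is the set of bounded linear operators $T\colon X\to Y$ for which there is $x\in X$ with $\|x\|=1$ and $\|Tx\|=\|T\|$. -/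

import Mathlib

open Filter Topology

open scoped ZeroAtInfty

/-- The Banach space `c₀` of scalar null sequences with the supremum norm
(`ℕ` carries the discrete topology, so continuity is automatic). -/
abbrev CZero (𝕜 : Type*) [RCLike 𝕜] : Type _ := C₀(ℕ, 𝕜)

/-- `NA(X, Y)`: the bounded operators `T` with `‖T x‖ = ‖T‖` for some `x` of norm one. -/
def NormAttaining (𝕜 X Y : Type*) [RCLike 𝕜] [NormedAddCommGroup X] [NormedSpace 𝕜 X]
    [NormedAddCommGroup Y] [NormedSpace 𝕜 Y] : Set (X →L[𝕜] Y) :=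
  {T | ∃ x : X, ‖x‖ = 1 ∧ ‖T x‖ = ‖T‖}

/-- `K(X, Y)`: the compact bounded operators from `X` to `Y`. -/
def CompactOps (𝕜 X Y : Type*) [RCLike 𝕜] [NormedAddCommGroup X] [NormedSpace 𝕜 X]
    [NormedAddCommGroup Y] [NormedSpace 𝕜 Y] : Set (X →L[𝕜] Y) :=
  {T | IsCompactOperator T}

/-- A Schauder basis is monotone when all of its partial sum projections are contractive. -/
def IsMonotoneBasis {𝕜 X : Type*} [RCLike 𝕜] [NormedAddCommGroup X] [NormedSpace 𝕜 X]
    (b : SchauderBasis 𝕜 X) : Prop :=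
  ∀ (n : ℕ) (x : X), ‖b.proj n x‖ ≤ ‖x‖

/-- A Schauder basis is shrinking when its coordinate functionals form a Schauder basis of the
dual space (with its norm topology). -/
def IsShrinkingBasis {𝕜 X : Type*} [RCLike 𝕜] [NormedAddCommGroup X] [NormedSpace 𝕜 X]
    (b : SchauderBasis 𝕜 X) : Prop :=
  ∃ d : SchauderBasis 𝕜 (StrongDual 𝕜 X), d.basis = b.coord

/-!
The dual of a subspace `X` of `c₀` has the weak-star Kadec–Klee property
(`tendsto_of_tendsto_apply_of_norm_le`): if `g i → f` pointwise on `X` and `‖g i‖ ≤ ‖f‖`, then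
`g i → f` in norm. Indeed, let `x` in the unit ball of `X` almost norm `f`, hence almost norm `g i`
for late `i`, and let `N` be such that the coordinates of `x` beyond `N` are small. If `w` is in the
unit ball of `X` and its first `N` coordinates are small, then `‖x + θ w‖` is hardly more than `1`
for each unimodular `θ`, so `|g i x| + |g i w|` is hardly more than `‖f‖`, and `g i w` is small.
Thus `g i` and `f` are uniformly small on such `w`, and modulo such `w` the unit ball of `X` has
finite nets, on which pointwise convergence is uniform.

For a monotone basis with partial sum projections `P n`, the functionals `f ∘ P n` tend to `f`
pointwise and have norm at most `‖f‖`, so they tend to `f` in norm; they are the partial sums of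
the expansion of `f` in the coordinate functionals, and so the basis is shrinking. The convergence
is uniform over the totally bounded set of functionals `φ ∘ T` with `‖φ‖ ≤ 1` when `T` is compact,
so that `T ∘ P n → T` in norm. Finally `T ∘ P n` attains its norm: by monotonicity its norm is its
supremum on the unit ball of the finite-dimensional range of `P n`, which is compact.
-/

/-! ### Finite nets -/

section FiniteNets

variable {𝕜 E : Type*} [RCLike 𝕜]

/-- If finitely many scalar functions `u · k` are bounded on `s`, then `s` has finite nets for the
pseudometric given by the maximum over `k` of `‖u x k - u y k‖`, with centres in `s`. -/
theorem exists_finite_net_of_bounded {ι : Type*} [Finite ι] (u : E → ι → 𝕜) (s : Set E)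
    {C : ℝ} (hC : ∀ x ∈ s, ∀ k, ‖u x k‖ ≤ C) {ε : ℝ} (hε : 0 < ε) :
    ∃ t ⊆ s, t.Finite ∧ ∀ x ∈ s, ∃ y ∈ t, ∀ k, ‖u x k - u y k‖ ≤ ε := by
  have := Fintype.ofFinite ι
  have hbd : Bornology.IsBounded (u '' s) := by
    refine isBounded_iff_forall_norm_le.2 ⟨max C 0, ?_⟩
    rintro _ ⟨x, hx, rfl⟩
    exact (pi_norm_le_iff_of_nonneg (le_max_right _ _)).2
      fun k => (hC x hx k).trans (le_max_left _ _)
  have htb : TotallyBounded (u '' s) :=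
    hbd.isCompact_closure.totallyBounded.subset subset_closure
  obtain ⟨t, hts, htf, hcov⟩ := Set.exists_subset_image_finite_and.1
    (Metric.finite_approx_of_totallyBounded htb ε hε)
  refine ⟨t, hts, htf, fun x hx => ?_⟩
  have hx' := hcov (Set.mem_image_of_mem u hx)
  simp only [Set.mem_iUnion, Metric.mem_ball] at hx'
  obtain ⟨_, ⟨y, hy, rfl⟩, hxy⟩ := hx'
  refine ⟨y, hy, fun k => ?_⟩
  rw [dist_eq_norm] at hxy
  exact (norm_le_pi_norm (u x - u y) k).trans hxy.le

end FiniteNets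

/-! ### The weak-star Kadec–Klee property of the dual of a subspace of `c₀` -/

section KadecKlee

variable {𝕜 : Type*} [RCLike 𝕜]

theorem exists_norm_one_norm_add_mul_eq (a b : 𝕜) :
    ∃ θ : 𝕜, ‖θ‖ = 1 ∧ ‖a + θ * b‖ = ‖a‖ + ‖b‖ := by
  rcases eq_or_ne a 0 with rfl | ha
  · exact ⟨1, by simp⟩
  rcases eq_or_ne b 0 with rfl | hb
  · exact ⟨1, by simp⟩
  have ha' : (‖a‖ : 𝕜) ≠ 0 := by simpa using ha
  refine ⟨a * ‖b‖ / (b * ‖a‖), ?_, ?_⟩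
  · have h1 := norm_ne_zero_iff.2 ha
    have h2 := norm_ne_zero_iff.2 hb
    simp only [norm_div, norm_mul, RCLike.norm_ofReal, abs_norm]
    field_simp
  · have h : a + a * ‖b‖ / (b * ‖a‖) * b = a * ((1 + ‖b‖ / ‖a‖ : ℝ) : 𝕜) := by
      push_cast
      field_simp
    rw [h, norm_mul, RCLike.norm_ofReal, abs_of_nonneg (by positivity)]
    have h1 := norm_ne_zero_iff.2 ha
    field_simp

theorem CZero.norm_le {x : CZero 𝕜} {C : ℝ} (hC : 0 ≤ C) (h : ∀ k, ‖x k‖ ≤ C) : ‖x‖ ≤ C :=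
  (BoundedContinuousFunction.norm_le hC).2 h

theorem CZero.exists_forall_ge_norm_apply_le (x : CZero 𝕜) {ε : ℝ} (hε : 0 < ε) :
    ∃ N, ∀ k, N ≤ k → ‖x k‖ ≤ ε := by
  have h : Tendsto (fun k => ‖x k‖) atTop (𝓝 0) := by
    have := (zero_at_infty x).norm
    rwa [cocompact_eq_atTop, norm_zero] at this
  exact eventually_atTop.1 (h.eventually_le_const hε)

variable {E : Type*} [NormedAddCommGroup E] [NormedSpace 𝕜 E]

theorem norm_coord_le (J : E →ₗᵢ[𝕜] CZero 𝕜) (x : E) (k : ℕ) : ‖J x k‖ ≤ ‖x‖ :=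
  ((J x).toBCF.norm_coe_le_norm k).trans_eq (J.norm_map x)

/-- A functional that almost attains its norm at `x` is small at the vectors whose large coordinates
are disjoint from those of `x`. -/
theorem norm_apply_le_of_almost_disjoint (J : E →ₗᵢ[𝕜] CZero 𝕜) {g : StrongDual 𝕜 E} {c ε : ℝ}
    (hg : ‖g‖ ≤ c) (hε : 0 ≤ ε) {x w : E} (hx : ‖x‖ ≤ 1) (hw : ‖w‖ ≤ 1) (hgx : c - ε ≤ ‖g x‖)
    {N : ℕ} (hxN : ∀ k, N ≤ k → ‖J x k‖ ≤ ε) (hwN : ∀ k < N, ‖J w k‖ ≤ ε) :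
    ‖g w‖ ≤ (c + 1) * ε := by
  obtain ⟨θ, hθ, hsum⟩ := exists_norm_one_norm_add_mul_eq (g x) (g w)
  have hnorm : ‖x + θ • w‖ ≤ 1 + ε := by
    rw [← J.norm_map, map_add, map_smul]
    refine CZero.norm_le (by positivity) fun k => ?_
    have hk : ‖J x k + θ * J w k‖ ≤ ‖J x k‖ + ‖J w k‖ :=
      (norm_add_le _ _).trans_eq (by rw [norm_mul, hθ, one_mul])
    refine hk.trans ?_
    rcases lt_or_ge k N with h | h
    · exact add_le_add ((norm_coord_le J x k).trans hx) (hwN k h)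
    · rw [add_comm 1]
      exact add_le_add (hxN k h) ((norm_coord_le J w k).trans hw)
  have hle : ‖g x‖ + ‖g w‖ ≤ c * (1 + ε) := by
    rw [← hsum]
    calc ‖g x + θ * g w‖ = ‖g (x + θ • w)‖ := by simp
      _ ≤ c * (1 + ε) := g.le_of_opNorm_le_of_le hg hnorm
  linarith

/-- The weak-star Kadec–Klee property of the dual of a subspace of `c₀`; the subspace is given as a
normed space with an isometric embedding `J` in `c₀`. -/
theorem tendsto_of_tendsto_apply_of_norm_le (J : E →ₗᵢ[𝕜] CZero 𝕜) {ι : Type*}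
    {l : Filter ι} {g : ι → StrongDual 𝕜 E} {f : StrongDual 𝕜 E} (hg : ∀ i, ‖g i‖ ≤ ‖f‖)
    (h : ∀ x, Tendsto (fun i => g i x) l (𝓝 (f x))) : Tendsto g l (𝓝 f) := by
  rw [Metric.tendsto_nhds]
  intro δ hδ
  -- The upper bound for `‖g i - f‖` will be `4 (‖f‖ + 1) ε + ε`: twice the estimate for almost
  -- disjoint vectors for each of `g i` and `f`, and `ε` on the finite net.
  obtain ⟨ε, hε, hεδ⟩ : ∃ ε > 0, 4 * ((‖f‖ + 1) * ε) + ε < δ := by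
    refine ⟨δ / (8 * (‖f‖ + 1)), by positivity, ?_⟩
    have h0 := norm_nonneg f
    have h1 : (‖f‖ + 1) * (δ / (8 * (‖f‖ + 1))) = δ / 8 := by field_simp
    have h2 : δ / (8 * (‖f‖ + 1)) ≤ δ / 8 :=
      div_le_div_of_nonneg_left hδ.le (by norm_num) (by linarith)
    linarith
  obtain ⟨x, hx, hfx⟩ : ∃ x : E, ‖x‖ ≤ 1 ∧ ‖f‖ - ε < ‖f x‖ := by
    by_contra! hcon
    -- If `‖f‖ < ε`, then `0` almost norms `f`; otherwise `‖f‖ - ε` is a legitimate norm bound.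
    rcases lt_or_ge ‖f‖ ε with hlt | hge
    · have := hcon 0 (by simp)
      simp only [map_zero, norm_zero] at this
      linarith
    · have := f.opNorm_le_of_unit_norm (C := ‖f‖ - ε) (by linarith) fun x hx => hcon x hx.le
      linarith
  obtain ⟨N, hN⟩ := CZero.exists_forall_ge_norm_apply_le (J x) hε
  obtain ⟨t, hts, htf, hnet⟩ := exists_finite_net_of_bounded
    (fun (z : E) (k : Fin N) => J z k) {z | ‖z‖ ≤ 1} (C := 1)
    (fun z hz k => (norm_coord_le J z k).trans hz) hε
  have hev : ∀ᶠ i in l, ∀ y ∈ t, ‖g i y - f y‖ ≤ ε := by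
    refine (Filter.eventually_all_finite htf).2 fun y _ => ?_
    have := tendsto_iff_norm_sub_tendsto_zero.1 (h y)
    exact this.eventually_le_const hε
  filter_upwards [hev, (h x).norm.eventually_const_lt hfx] with i hi hix
  rw [dist_eq_norm]
  refine lt_of_le_of_lt (ContinuousLinearMap.opNorm_le_of_unit_norm (by positivity)
    fun z hz => ?_) hεδ
  obtain ⟨y, hy, hyz⟩ := hnet z hz.le
  -- `z - y` has norm at most `2`, so the smallness estimate applies to its half.
  obtain ⟨w, hw⟩ : ∃ w : E, w = (2⁻¹ : 𝕜) • (z - y) := ⟨_, rfl⟩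
  have hzw : z = y + (2 : 𝕜) • w := by rw [hw, smul_inv_smul₀ two_ne_zero]; abel
  have hw1 : ‖w‖ ≤ 1 := by
    have h2 : ‖z - y‖ ≤ 1 + 1 := (norm_sub_le _ _).trans (add_le_add hz.le (hts hy))
    rw [hw, norm_smul, norm_inv, RCLike.norm_ofNat]
    linarith
  have hwN : ∀ k < N, ‖J w k‖ ≤ ε := by
    intro k hk
    have h2 : ‖J z k - J y k‖ ≤ ε := hyz ⟨k, hk⟩
    have h3 : J w k = 2⁻¹ * (J z k - J y k) := by
      rw [hw, map_smul, map_sub]; rfl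
    rw [h3, norm_mul, norm_inv, RCLike.norm_ofNat]
    linarith
  have hgw := norm_apply_le_of_almost_disjoint J (hg i) hε.le hx hw1 hix.le hN hwN
  have hfw := norm_apply_le_of_almost_disjoint J le_rfl hε.le hx hw1 hfx.le hN hwN
  have hdec : (g i - f) z = (2 : 𝕜) * g i w - (2 : 𝕜) * f w + (g i y - f y) := by
    rw [hzw]
    simp only [sub_apply, map_add, map_smul, smul_eq_mul]
    ring
  calc ‖(g i - f) z‖ ≤ ‖(2 : 𝕜) * g i w‖ + ‖(2 : 𝕜) * f w‖ + ‖g i y - f y‖ := by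
        rw [hdec]
        exact (norm_add_le _ _).trans (add_le_add_left (norm_sub_le _ _) _)
    _ ≤ 2 * ((‖f‖ + 1) * ε) + 2 * ((‖f‖ + 1) * ε) + ε := by
        rw [norm_mul, norm_mul, RCLike.norm_ofNat]
        gcongr
        exact hi y hy
    _ = 4 * ((‖f‖ + 1) * ε) + ε := by ring

end KadecKlee

/-! ### Shrinking bases -/

section Shrinking

variable {𝕜 E : Type*} [RCLike 𝕜] [NormedAddCommGroup E] [NormedSpace 𝕜 E]

/-- A basis is shrinking as soon as the adjoints of its partial sum projections tend strongly to
the identity. -/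
theorem isShrinkingBasis_of_tendsto_comp_proj (b : SchauderBasis 𝕜 E)
    (h : ∀ f : StrongDual 𝕜 E, Tendsto (fun n => f.comp (b.proj n)) atTop (𝓝 f)) :
    IsShrinkingBasis b := by
  refine ⟨{ basis := b.coord
            coord := fun n => NormedSpace.inclusionInDoubleDual 𝕜 E (b n)
            ortho := fun i j => ?_
            expansion := fun f => ?_ }, rfl⟩
  · simp [NormedSpace.dual_def, b.ortho, Pi.single_apply, eq_comm]
  · rw [HasSum, SummationFilter.conditional_filter_eq_map_range, tendsto_map'_iff]
    refine (h f).congr fun n => ?_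
    ext x
    simp [NormedSpace.dual_def, sum_apply, mul_comm]

/-- The Kadec–Klee property applies to `f ∘ P n` because monotonicity gives `‖f ∘ P n‖ ≤ ‖f‖`. -/
theorem IsMonotoneBasis.tendsto_comp_proj (J : E →ₗᵢ[𝕜] CZero 𝕜) {b : SchauderBasis 𝕜 E}
    (hb : IsMonotoneBasis b) (f : StrongDual 𝕜 E) :
    Tendsto (fun n => f.comp (b.proj n)) atTop (𝓝 f) := by
  refine tendsto_of_tendsto_apply_of_norm_le J (fun n => ?_) fun x =>
    (f.continuous.tendsto x).comp (b.tendsto_proj x)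
  refine ContinuousLinearMap.opNorm_le_bound _ (norm_nonneg f) fun x => ?_
  exact f.le_opNorm_of_le (hb n x)

end Shrinking

/-! ### Approximation of compact operators -/

section Compact

variable {𝕜 E Y : Type*} [RCLike 𝕜] [NormedAddCommGroup E] [NormedSpace 𝕜 E]
  [NormedAddCommGroup Y] [NormedSpace 𝕜 Y]

/-- The functionals `φ ∘ T` with `‖φ‖ ≤ 1` form a totally bounded set when `T` is compact: this is
the essential part of Schauder's theorem on adjoints of compact operators. -/
theorem IsCompactOperator.exists_finite_net_comp {T : E →L[𝕜] Y} (hT : IsCompactOperator T)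
    {ε : ℝ} (hε : 0 < ε) :
    ∃ t : Set (StrongDual 𝕜 Y), t.Finite ∧
      ∀ φ : StrongDual 𝕜 Y, ‖φ‖ ≤ 1 → ∃ ψ ∈ t, ‖φ.comp T - ψ.comp T‖ ≤ ε := by
  have htb : TotallyBounded (T '' Metric.closedBall 0 1) :=
    (hT.isCompact_closure_image_closedBall 1).totallyBounded.subset subset_closure
  obtain ⟨s, hs, hsf, hcov⟩ :=
    Metric.finite_approx_of_totallyBounded htb (ε / 3) (by positivity)
  have := hsf.to_subtype
  obtain ⟨t, ht, htf, hnet⟩ := exists_finite_net_of_bounded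
    (fun (φ : StrongDual 𝕜 Y) (y : s) => φ y) {φ | ‖φ‖ ≤ 1} (C := ‖T‖) (by
      rintro φ hφ ⟨y, hy⟩
      obtain ⟨x, hx, rfl⟩ := hs hy
      refine (φ.le_of_opNorm_le_of_le hφ (T.le_of_opNorm_le_of_le le_rfl
        (mem_closedBall_zero_iff.1 hx))).trans_eq (by ring)) (ε := ε / 3) (by positivity)
  refine ⟨t, htf, fun φ hφ => ?_⟩
  obtain ⟨ψ, hψ, hφψ⟩ := hnet φ hφ
  refine ⟨ψ, hψ, ContinuousLinearMap.opNorm_le_of_unit_norm hε.le fun x hx => ?_⟩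
  have hx' := hcov (Set.mem_image_of_mem T (mem_closedBall_zero_iff.2 hx.le))
  simp only [Set.mem_iUnion, Metric.mem_ball, dist_eq_norm] at hx'
  obtain ⟨y, hy, hxy⟩ := hx'
  have h1 : ‖φ (T x - y)‖ ≤ 1 * (ε / 3) := φ.le_of_opNorm_le_of_le hφ hxy.le
  have h2 : ‖ψ (T x - y)‖ ≤ 1 * (ε / 3) := ψ.le_of_opNorm_le_of_le (ht hψ) hxy.le
  have h3 : ‖φ y - ψ y‖ ≤ ε / 3 := hφψ ⟨y, hy⟩
  have hdec : (φ.comp T - ψ.comp T) x = φ (T x - y) - ψ (T x - y) + (φ y - ψ y) := by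
    simp only [sub_apply, ContinuousLinearMap.comp_apply, map_sub]
    ring
  rw [hdec]
  have h4 := norm_add_le (φ (T x - y) - ψ (T x - y)) (φ y - ψ y)
  have h5 := norm_sub_le (φ (T x - y)) (ψ (T x - y))
  linarith

/-- If the adjoints of contractions `P i` tend strongly to the identity, then `T ∘ P i` tends to `T`
in norm for each compact operator `T`. -/
theorem IsCompactOperator.tendsto_comp {ι : Type*} {l : Filter ι} {T : E →L[𝕜] Y}
    (hT : IsCompactOperator T) {P : ι → E →L[𝕜] E} (hP : ∀ i x, ‖P i x‖ ≤ ‖x‖)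
    (h : ∀ f : StrongDual 𝕜 E, Tendsto (fun i => f.comp (P i)) l (𝓝 f)) :
    Tendsto (fun i => T.comp (P i)) l (𝓝 T) := by
  rw [Metric.tendsto_nhds]
  intro δ hδ
  obtain ⟨t, htf, hnet⟩ := hT.exists_finite_net_comp (ε := δ / 6) (by positivity)
  have hev : ∀ᶠ i in l, ∀ ψ ∈ t, ‖(ψ.comp T).comp (P i) - ψ.comp T‖ ≤ δ / 6 := by
    refine (Filter.eventually_all_finite htf).2 fun ψ _ => ?_
    have := tendsto_iff_norm_sub_tendsto_zero.1 (h (ψ.comp T))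
    exact this.eventually_le_const (by positivity)
  filter_upwards [hev] with i hi
  rw [dist_eq_norm]
  refine lt_of_le_of_lt (ContinuousLinearMap.opNorm_le_of_unit_norm (C := δ / 2) (by positivity)
    fun x hx => ?_) (half_lt_self hδ)
  -- A functional norming `(T ∘ P i - T) x` is replaced by a member `ψ` of the finite net.
  obtain ⟨φ, hφ, hφx⟩ := exists_dual_vector'' 𝕜 ((T.comp (P i) - T) x)
  obtain ⟨ψ, hψ, hφψ⟩ := hnet φ hφ
  have h1 : ‖(φ.comp T - ψ.comp T) (P i x)‖ ≤ δ / 6 * 1 :=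
    ContinuousLinearMap.le_of_opNorm_le_of_le _ hφψ ((hP i x).trans hx.le)
  have h2 : ‖(φ.comp T - ψ.comp T) x‖ ≤ δ / 6 * 1 :=
    ContinuousLinearMap.le_of_opNorm_le_of_le _ hφψ hx.le
  have h3 : ‖((ψ.comp T).comp (P i) - ψ.comp T) x‖ ≤ δ / 6 * 1 :=
    ContinuousLinearMap.le_of_opNorm_le_of_le _ (hi ψ hψ) hx.le
  have hdec : φ ((T.comp (P i) - T) x) = (φ.comp T - ψ.comp T) (P i x)
      - (φ.comp T - ψ.comp T) x + ((ψ.comp T).comp (P i) - ψ.comp T) x := by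
    simp only [sub_apply, ContinuousLinearMap.comp_apply, map_sub]
    ring
  have h4 : ‖(T.comp (P i) - T) x‖ = ‖φ ((T.comp (P i) - T) x)‖ := by
    rw [hφx, RCLike.norm_ofReal, abs_norm]
  rw [h4, hdec]
  have h5 := norm_add_le ((φ.comp T - ψ.comp T) (P i x) - (φ.comp T - ψ.comp T) x)
    (((ψ.comp T).comp (P i) - ψ.comp T) x)
  have h6 := norm_sub_le ((φ.comp T - ψ.comp T) (P i x)) ((φ.comp T - ψ.comp T) x)
  linarith

/-- If `P` is a contractive projection of finite rank, then every `T ∘ P` attains its norm. -/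
theorem comp_mem_normAttaining [Nontrivial E] (T : E →L[𝕜] Y) {P : E →L[𝕜] E}
    [FiniteDimensional 𝕜 P.toLinearMap.range] (hPP : ∀ x, P (P x) = P x)
    (hP : ∀ x, ‖P x‖ ≤ ‖x‖) : T.comp P ∈ NormAttaining 𝕜 E Y := by
  have := FiniteDimensional.proper 𝕜 P.toLinearMap.range
  obtain ⟨x, hx, hmax⟩ := (isCompact_closedBall (0 : P.toLinearMap.range) 1).exists_isMaxOn
    ⟨0, by simp⟩ (f := fun x => ‖T.comp P x‖) (by fun_prop)
  have hx1 : ‖(x : E)‖ ≤ 1 := mem_closedBall_zero_iff.1 hx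
  have hle : ‖T.comp P‖ ≤ ‖T.comp P x‖ := by
    refine ContinuousLinearMap.opNorm_le_of_unit_norm (norm_nonneg _) fun z hz => ?_
    have := hmax (a := ⟨P z, LinearMap.mem_range_self _ z⟩)
      (mem_closedBall_zero_iff.2 ((hP z).trans hz.le))
    simpa [hPP] using this
  -- A maximizer `x` may be short only if `T ∘ P = 0`, and then any unit vector will do.
  rcases eq_or_ne (T.comp P) 0 with h0 | h0
  · obtain ⟨z, hz⟩ := exists_ne (0 : E)
    exact ⟨_, norm_smul_inv_norm (𝕜 := 𝕜) hz, by simp [h0]⟩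
  · refine ⟨x, le_antisymm hx1 ?_, le_antisymm ?_ hle⟩
    · refine le_of_mul_le_mul_left ?_ (norm_pos_iff.2 h0)
      rw [mul_one]
      exact hle.trans ((T.comp P).le_opNorm x)
    · exact (T.comp P).unit_le_opNorm x hx1

end Compact

theorem mainTheorem9 {𝕜 : Type*} [RCLike 𝕜] (X : Submodule 𝕜 (CZero 𝕜))
    (hX : IsClosed (X : Set (CZero 𝕜)))
    (b : SchauderBasis 𝕜 X) (hb : IsMonotoneBasis b) :
    IsShrinkingBasis b ∧
      ∀ (Y : Type*) [NormedAddCommGroup Y] [NormedSpace 𝕜 Y] [CompleteSpace Y],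
        CompactOps 𝕜 X Y ⊆ closure (NormAttaining 𝕜 X Y ∩ CompactOps 𝕜 X Y) := by
  have h := hb.tendsto_comp_proj X.subtypeₗᵢ
  refine ⟨isShrinkingBasis_of_tendsto_comp_proj b h, ?_⟩
  intro Y _ _ _ T hT
  have : Nontrivial X := ⟨b 0, 0, b.linearIndependent.ne_zero 0⟩
  have hfin : ∀ n, FiniteDimensional 𝕜 (b.proj n).toLinearMap.range := fun n => by
    rw [b.range_proj_eq_span]
    exact FiniteDimensional.span_of_finite 𝕜 ((Finset.finite_toSet _).image _)
  refine mem_closure_of_tendsto (IsCompactOperator.tendsto_comp hT hb h)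
    (Eventually.of_forall fun n => ⟨?_, IsCompactOperator.comp_clm hT (b.proj n)⟩)
  exact comp_mem_normAttaining T (fun x => by rw [b.proj_comp, min_self]) (hb n)
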